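/- Let $\mathbb{K}$ be a field and let $E=(E^0,E^1,r,s)$ be a directed graph whose vertex set $E^0$ is finite and nonempty (the edge set $E^1$ is arbitrary, loops and multiple edges are allowed). The Leavitt path algebra $L_{\mathbb{K}}(E)$ is the $\mathbb{K}$-algebra generated by pairwise orthogonal idempotents $v$ ($v\in E^0$) and elements $e,e^*$ ($e\in E^1$) subject to: $s(e)e=e=e\,r(e)$ and $r(e)e^*=e^*=e^*s(e)$ for all $e\in E^1$; $e^*e=r(e)$, and $e^*f=0$ for edges $e\neq f$; and $v=\sum_{s(e)=v}ee^*$ for every vertex $v$ that emits at least one and only finitely many edges. Since $E^0$ is finite, it is unital with unit $\sum_{v\in E^0}v$. A $\mathbb{K}$-algebra $\mathcal{A}$ is (left) algebraically amenable if for every $\varepsilon>0$ and every finite set $\mathcal{F}\subset\mathcal{A}$ there is a nonzero finite-dimensional linear subspace $W\subset\mathcal{A}$ with $\dim(aW+W)\le(1+\varepsilon)\dim(W)$ for all $a\in\mathcal{F}$. A nonzero unital algebra $\mathcal{A}$ is properly infinite if there are idempotents $e_1,e_2\in\mathcal{A}$ with $e_1e_2=e_2e_1=0$ and $e_1\sim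 1\sim e_2$, where $e\sim f$ means that $e=xy$ and $f=yx$ for some $x,y\in\mathcal{A}$. Then $L_{\mathbb{K}}(E)$ is not algebraically amenable if and only if it is properly infinite. -/

import Mathlib

universe u v w

/-! ### Algebraic amenability and proper infiniteness -/

section Algebras

/-- A `K`-algebra `A` (associative, not necessarily unital) is (left) algebraically amenable if for
every `ε > 0` and every finite set `F ⊆ A` there is a left `(F, ε)`-Følner subspace, that is, a
nonzero finite-dimensional linear subspace `W` of `A` with `dim (a W + W) / dim W ≤ 1 + ε` for all
`a ∈ F`. -/
def IsAlgebraicallyAmenable (K : Type u) (A : Type v) [Field K] [NonUnitalRing A] [Module K A]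
    [IsScalarTower K A A] [SMulCommClass K A A] : Prop :=
  ∀ ε : ℝ, 0 < ε → ∀ F : Finset A, ∃ W : Submodule K A,
    W ≠ ⊥ ∧ FiniteDimensional K W ∧
      ∀ a ∈ F,
        (Module.finrank K ↥(W.map (LinearMap.mulLeft K a) ⊔ W) : ℝ) / (Module.finrank K W : ℝ)
          ≤ 1 + ε

/-- Murray–von Neumann equivalence `e ∼ f`: there are `x, y` with `e = x y` and `f = y x`. -/
def MurrayVonNeumannEquiv {A : Type v} [Mul A] (e f : A) : Prop :=
  ∃ x y : A, e = x * y ∧ f = y * x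

/-- An idempotent `e` of `A` is properly infinite if there are orthogonal idempotents
`e₁, e₂ ∈ e A e` with `e₁ ∼ e ∼ e₂`. -/
def IsProperlyInfiniteIdempotent {A : Type v} [NonUnitalRing A] (e : A) : Prop :=
  IsIdempotentElem e ∧
    ∃ e₁ e₂ : A,
      IsIdempotentElem e₁ ∧ IsIdempotentElem e₂ ∧ e₁ * e₂ = 0 ∧ e₂ * e₁ = 0 ∧
      (∃ a, e₁ = e * a * e) ∧ (∃ a, e₂ = e * a * e) ∧
      MurrayVonNeumannEquiv e₁ e ∧ MurrayVonNeumannEquiv e e₂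

/-- A unital algebra is properly infinite if it is nonzero and its unit is a properly infinite
idempotent. -/
def IsProperlyInfinite (A : Type v) [Ring A] : Prop :=
  Nontrivial A ∧ IsProperlyInfiniteIdempotent (1 : A)

end Algebras

/-! ### Directed graphs -/

/-- A directed graph with vertex set `V` and edge set `E`, given by its source and range maps.
Loops and multiple edges are allowed, and `V` and `E` may be infinite. -/
structure DirectedGraph (V : Type v) (E : Type w) where
  source : E → V
  range : E → V

/-- A vertex is regular if it emits at least one and only finitely many edges. -/
structure DirectedGraph.IsRegular {V : Type v} {E : Type w} (G : DirectedGraph V E) (x : V) :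
    Prop where
  finite : (G.source ⁻¹' {x}).Finite
  nonempty : (G.source ⁻¹' {x}).Nonempty

/-! ### Leavitt path algebras -/

namespace LeavittPath

/-- The generators of the Leavitt path algebra: vertices, edges and ghost edges. -/
inductive Gen (V : Type v) (E : Type w) : Type (max v w)
  | vertex (x : V)
  | edge (e : E)
  | ghost (e : E)

section Relations

variable (K : Type u) {V : Type v} {E : Type w} [Field K]

/-- A vertex, as an element of the free algebra on the generators. -/
abbrev fv (x : V) : FreeAlgebra K (Gen V E) := FreeAlgebra.ι K (Gen.vertex x)

/-- An edge, as an element of the free algebra on the generators. -/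
abbrev fe (e : E) : FreeAlgebra K (Gen V E) := FreeAlgebra.ι K (Gen.edge e)

/-- A ghost edge, as an element of the free algebra on the generators. -/
abbrev fg (e : E) : FreeAlgebra K (Gen V E) := FreeAlgebra.ι K (Gen.ghost e)

/-- The defining relations of the Leavitt path algebra of `G`. -/
inductive Rel (G : DirectedGraph V E) :
    FreeAlgebra K (Gen V E) → FreeAlgebra K (Gen V E) → Prop
  | vertex_idem (x : V) : Rel G (fv K x * fv K x) (fv K x)
  | vertex_orth (x y : V) (h : x ≠ y) : Rel G (fv K x * fv K y) 0
  | source_edge (e : E) : Rel G (fv K (G.source e) * fe K e) (fe K e)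
  | edge_range (e : E) : Rel G (fe K e * fv K (G.range e)) (fe K e)
  | range_ghost (e : E) : Rel G (fv K (G.range e) * fg K e) (fg K e)
  | ghost_source (e : E) : Rel G (fg K e * fv K (G.source e)) (fg K e)
  | ck1_same (e : E) : Rel G (fg K e * fe K e) (fv K (G.range e))
  | ck1_ne (e f : E) (h : e ≠ f) : Rel G (fg K e * fe K f) 0
  | ck2 (x : V) (h : G.IsRegular x) :
      Rel G (fv K x) (∑ e ∈ h.finite.toFinset, fe K e * fg K e)

/-- The unital `K`-algebra presented by the generators and relations of the Leavitt path algebra.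
Since no relation involves the unit, this is the algebra obtained from the Leavitt path algebra by
formally adjoining a (new) unit. -/
abbrev Unitized (G : DirectedGraph V E) : Type (max u v w) := RingQuot (Rel K G)

/-- The image of a generator in the presented unital algebra. -/
def gen (G : DirectedGraph V E) (g : Gen V E) : Unitized K G :=
  RingQuot.mkAlgHom K (Rel K G) (FreeAlgebra.ι K g)

end Relations

end LeavittPath

/-- The Leavitt path algebra `L_K(G)` of an arbitrary directed graph `G`: the (not necessarily
unital) `K`-algebra with generators the vertices, edges and ghost edges of `G`, subject to the
relations `LeavittPath.Rel`. It is the non-unital subalgebra generated by the generators inside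
the unital algebra with the same presentation, i.e. the image there of the non-unital free algebra.
-/
abbrev LeavittPathAlgebra (K : Type u) {V : Type v} {E : Type w} [Field K]
    (G : DirectedGraph V E) : Type (max u v w) :=
  NonUnitalAlgebra.adjoin K (Set.range (LeavittPath.gen K G))

namespace LeavittPathAlgebra

section Unit

variable (K : Type u) {V : Type v} {E : Type w} [Field K] (G : DirectedGraph V E)

/-- A vertex, as an element of the Leavitt path algebra. -/
def vertex (x : V) : LeavittPathAlgebra K G :=
  ⟨LeavittPath.gen K G (.vertex x), NonUnitalAlgebra.subset_adjoin K ⟨_, rfl⟩⟩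

/-- An edge, as an element of the Leavitt path algebra. -/
def edge (e : E) : LeavittPathAlgebra K G :=
  ⟨LeavittPath.gen K G (.edge e), NonUnitalAlgebra.subset_adjoin K ⟨_, rfl⟩⟩

/-- A ghost edge, as an element of the Leavitt path algebra. -/
def ghost (e : E) : LeavittPathAlgebra K G :=
  ⟨LeavittPath.gen K G (.ghost e), NonUnitalAlgebra.subset_adjoin K ⟨_, rfl⟩⟩

variable {K G}

theorem rel_eq {a b : FreeAlgebra K (LeavittPath.Gen V E)} (h : LeavittPath.Rel K G a b) :
    RingQuot.mkAlgHom K (LeavittPath.Rel K G) a = RingQuot.mkAlgHom K (LeavittPath.Rel K G) b :=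
  RingQuot.mkAlgHom_rel K h

/-- If there are finitely many vertices, their sum fixes every generator on both sides. -/
theorem sum_vertex_mul_gen [Fintype V] (g : LeavittPath.Gen V E) :
    (∑ x : V, LeavittPath.gen K G (.vertex x)) * LeavittPath.gen K G g = LeavittPath.gen K G g ∧
      LeavittPath.gen K G g * (∑ x : V, LeavittPath.gen K G (.vertex x))
        = LeavittPath.gen K G g := by
  classical
  have orth : ∀ x y : V, LeavittPath.gen K G (.vertex x) * LeavittPath.gen K G (.vertex y)
      = if x = y then LeavittPath.gen K G (.vertex x) else 0 := by
    intro x y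
    split_ifs with h
    · subst h
      simpa [LeavittPath.gen] using rel_eq (LeavittPath.Rel.vertex_idem (K := K) (G := G) x)
    · simpa [LeavittPath.gen] using rel_eq (LeavittPath.Rel.vertex_orth (K := K) (G := G) x y h)
  have left : ∀ (y : V) (a : LeavittPath.Unitized K G), LeavittPath.gen K G (.vertex y) * a = a →
      (∑ x : V, LeavittPath.gen K G (.vertex x)) * a = a := by
    intro y a h
    rw [← h, ← mul_assoc, Finset.sum_mul]
    simp [orth]
  have right : ∀ (y : V) (a : LeavittPath.Unitized K G), a * LeavittPath.gen K G (.vertex y) = a →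
      a * (∑ x : V, LeavittPath.gen K G (.vertex x)) = a := by
    intro y a h
    rw [← h, mul_assoc, Finset.mul_sum]
    simp [orth]
  cases g with
  | vertex x => exact ⟨left x _ (by simp [orth]), right x _ (by simp [orth])⟩
  | edge e =>
    exact ⟨left (G.source e) _
        (by simpa [LeavittPath.gen] using rel_eq (LeavittPath.Rel.source_edge (K := K) (G := G) e)),
      right (G.range e) _
        (by simpa [LeavittPath.gen] using rel_eq (LeavittPath.Rel.edge_range (K := K) (G := G) e))⟩
  | ghost e =>
    exact ⟨left (G.range e) _
        (by simpa [LeavittPath.gen] using rel_eq (LeavittPath.Rel.range_ghost (K := K) (G := G) e)),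
      right (G.source e) _
        (by simpa [LeavittPath.gen] using
          rel_eq (LeavittPath.Rel.ghost_source (K := K) (G := G) e))⟩

/-- If there are finitely many vertices, their sum is a two-sided unit. -/
theorem sum_vertex_mul [Fintype V] (a : LeavittPathAlgebra K G) :
    (∑ x : V, vertex K G x) * a = a ∧ a * (∑ x : V, vertex K G x) = a := by
  obtain ⟨a, ha⟩ := a
  have hs : ((∑ x : V, vertex K G x : LeavittPathAlgebra K G) : LeavittPath.Unitized K G)
      = ∑ x : V, LeavittPath.gen K G (.vertex x) := by
    simp [vertex]
  suffices h : (∑ x : V, LeavittPath.gen K G (.vertex x)) * a = a ∧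
      a * (∑ x : V, LeavittPath.gen K G (.vertex x)) = a by
    refine ⟨Subtype.ext ?_, Subtype.ext ?_⟩
    · rw [NonUnitalSubalgebra.coe_mul, hs]; exact h.1
    · rw [NonUnitalSubalgebra.coe_mul, hs]; exact h.2
  induction ha using NonUnitalAlgebra.adjoin_induction with
  | mem x hx => obtain ⟨g, rfl⟩ := hx; exact sum_vertex_mul_gen g
  | add x y _ _ hx hy => exact ⟨by rw [mul_add, hx.1, hy.1], by rw [add_mul, hx.2, hy.2]⟩
  | zero => simp
  | mul x y _ _ hx hy => exact ⟨by rw [← mul_assoc, hx.1], by rw [mul_assoc, hy.2]⟩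
  | smul r x _ hx => exact ⟨by rw [mul_smul_comm, hx.1], by rw [smul_mul_assoc, hx.2]⟩

/-- The Leavitt path algebra of a graph with finitely many vertices is a unital ring, with unit
`∑ v` (the addition and multiplication are those of the Leavitt path algebra). -/
noncomputable instance instRing [Fintype V] : Ring (LeavittPathAlgebra K G) :=
  { (inferInstance : NonUnitalRing (LeavittPathAlgebra K G)) with
    one := ∑ x : V, vertex K G x
    one_mul := fun a => (sum_vertex_mul a).1
    mul_one := fun a => (sum_vertex_mul a).2 }

end Unit

end LeavittPathAlgebra

/-! Write $L$ for the algebra. Two distinct closed paths of equal length at a vertex $x$ give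
orthogonal isometries in the corner $xLx$: equal lengths prevent one path from extending the other.
Let $I$ be the ideal generated by all such branching vertices.

If $I$ contains every vertex, then $1=\sum_k y_k x_k z_k$ with branching $x_k$. Two isometries in a
corner produce infinitely many, enough to spread this sum into two orthogonal isometries of $L$
(`isProperlyInfiniteIdempotent_of_mem_sandwichIdeal`).

Otherwise fix a vertex $y\notin I$. The vertices in $I$ form a hereditary set, so paths ending at
$y$ meet no branching vertex, and those with edges in a finite set grow polynomially in number
(`exists_finset_paths`). Left multiplication by a generator changes path length by at most one, so
spans of such paths are nearly invariant (`exists_folner`). Only ghost edges acting on short paths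
can leave the span, and there are two remedies. If some $y\notin I$ is not regular, paths are
multiplied on the right by a nonzero $p=y-\sum ff^*$ that the relevant ghost edges annihilate. If
all vertices outside $I$ are regular, the relation $v=\sum ee^*$ yields paths of every length
outside $I$; a graded representation shows them independent, so dimensions are unbounded and short
paths can be discarded at negligible cost.

Conversely, orthogonal isometries map $W$ to two independent copies of itself, which excludes Følner
subspaces. -/

/-! ### Orthogonal isometries, amenability and proper infiniteness. -/

section ProperlyInfinite

variable {A : Type*} [NonUnitalRing A]

/-- Two orthogonal isometries witness that an algebra is not algebraically amenable. -/
theorem not_isAlgebraicallyAmenable_of_isometries {K : Type*} [Field K] [Module K A]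
    [IsScalarTower K A A] [SMulCommClass K A A] {u s₁ s₂ t₁ t₂ : A} (hu : ∀ a : A, u * a = a)
    (h₁₁ : t₁ * s₁ = u) (h₂₂ : t₂ * s₂ = u) (h₁₂ : t₁ * s₂ = 0) :
    ¬ IsAlgebraicallyAmenable K A := by
  classical
  intro h
  -- Both $s_iW+W$ contain $W$ and together they contain $s_1W\oplus s_2W$, so their dimensions add
  -- up to at least $3\dim W$, whereas $\varepsilon=1/4$ allows only $\frac52\dim W$.
  obtain ⟨W, hW, _, hF⟩ := h (1 / 4) (by norm_num) {s₁, s₂}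
  have hpos : 0 < Module.finrank K W := by
    have := (Submodule.nontrivial_iff_ne_bot).2 hW
    exact Module.finrank_pos
  have key : ∀ s t : A, t * s = u →
      Module.finrank K (W.map (LinearMap.mulLeft K s)) = Module.finrank K W := by
    intro s t hst
    have hinj : Function.Injective (LinearMap.mulLeft K s) := by
      intro a b hab
      have : s * a = s * b := hab
      rw [← hu a, ← hu b, ← hst, mul_assoc, mul_assoc, this]
    exact (LinearEquiv.finrank_eq (Submodule.equivMapOfInjective _ hinj W)).symm
  have hdisj : W.map (LinearMap.mulLeft K s₁) ⊓ W.map (LinearMap.mulLeft K s₂) = ⊥ := by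
    refine (Submodule.eq_bot_iff _).2 ?_
    rintro _ ⟨⟨a, -, rfl⟩, ⟨b, -, hb⟩⟩
    have hb : s₂ * b = s₁ * a := hb
    change s₁ * a = 0
    rw [← hu a, ← h₁₁, mul_assoc t₁, ← hb, ← mul_assoc t₁, h₁₂, zero_mul, mul_zero]
  have b₁ := hF s₁ (by simp)
  have b₂ := hF s₂ (by simp)
  have e₁ := key s₁ t₁ h₁₁
  have e₂ := key s₂ t₂ h₂₂
  generalize W.map (LinearMap.mulLeft K s₁) = X₁ at *
  generalize W.map (LinearMap.mulLeft K s₂) = X₂ at *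
  have f₁ : FiniteDimensional K X₁ := FiniteDimensional.of_finrank_pos (by omega)
  have f₂ : FiniteDimensional K X₂ := FiniteDimensional.of_finrank_pos (by omega)
  have hpos' : (0 : ℝ) < Module.finrank K W := by exact_mod_cast hpos
  rw [div_le_iff₀ hpos'] at b₁ b₂
  have d₁ := Submodule.finrank_sup_add_finrank_inf_eq X₁ X₂
  rw [hdisj, finrank_bot, e₁, e₂] at d₁
  have d₂ := Submodule.finrank_sup_add_finrank_inf_eq (X₁ ⊔ W) (X₂ ⊔ W)
  have d₃ : Module.finrank K W ≤ Module.finrank K ↥((X₁ ⊔ W) ⊓ (X₂ ⊔ W)) :=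
    Submodule.finrank_mono (le_inf le_sup_right le_sup_right)
  have d₄ : Module.finrank K ↥(X₁ ⊔ X₂) ≤ Module.finrank K ↥((X₁ ⊔ W) ⊔ (X₂ ⊔ W)) :=
    Submodule.finrank_mono (sup_le_sup le_sup_left le_sup_left)
  have d₅ : 2 * Module.finrank K W + Module.finrank K W ≤
      Module.finrank K ↥(X₁ ⊔ W) + Module.finrank K ↥(X₂ ⊔ W) := by omega
  have d₆ : (2 : ℝ) * Module.finrank K W + Module.finrank K W ≤
      Module.finrank K ↥(X₁ ⊔ W) + Module.finrank K ↥(X₂ ⊔ W) := by exact_mod_cast d₅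
  linarith

/-- Orthogonal isometries make an identity element properly infinite. -/
theorem isProperlyInfiniteIdempotent_of_isometries {u s₁ s₂ t₁ t₂ : A}
    (hu : ∀ a : A, u * a = a) (hu' : ∀ a : A, a * u = a)
    (h₁₁ : t₁ * s₁ = u) (h₂₂ : t₂ * s₂ = u) (h₁₂ : t₁ * s₂ = 0) (h₂₁ : t₂ * s₁ = 0) :
    IsProperlyInfiniteIdempotent u := by
  refine ⟨hu u, s₁ * t₁, s₂ * t₂, ?_, ?_, ?_, ?_, ⟨s₁ * t₁, by rw [hu, hu']⟩,
    ⟨s₂ * t₂, by rw [hu, hu']⟩, ⟨s₁, t₁, rfl, h₁₁.symm⟩, ⟨t₂, s₂, h₂₂.symm, rfl⟩⟩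
  · rw [IsIdempotentElem, mul_assoc, ← mul_assoc t₁, h₁₁, hu]
  · rw [IsIdempotentElem, mul_assoc, ← mul_assoc t₂, h₂₂, hu]
  · rw [mul_assoc, ← mul_assoc t₁, h₁₂, zero_mul, mul_zero]
  · rw [mul_assoc, ← mul_assoc t₂, h₂₁, zero_mul, mul_zero]

/-- A properly infinite identity element gives two orthogonal isometries. -/
theorem IsProperlyInfiniteIdempotent.exists_isometries {u : A}
    (h : IsProperlyInfiniteIdempotent u) (hu : ∀ a : A, u * a = a) (hu' : ∀ a : A, a * u = a) :
    ∃ s₁ s₂ t₁ t₂ : A, t₁ * s₁ = u ∧ t₂ * s₂ = u ∧ t₁ * s₂ = 0 ∧ t₂ * s₁ = 0 := by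
  obtain ⟨-, e₁, e₂, -, -, h12, h21, -, -, ⟨s₁, t₁, rfl, h1⟩, ⟨t₂, s₂, h2, rfl⟩⟩ := h
  have key : ∀ s t s' t' : A, u = t * s → u = t' * s' → s * t * (s' * t') = 0 → t * s' = 0 := by
    intro s t s' t' h h' h0
    calc t * s' = u * (t * s') * u := by rw [hu, hu']
      _ = t * s * (t * s') * (t' * s') := by rw [← h, ← h']
      _ = t * (s * t * (s' * t')) * s' := by simp only [mul_assoc]
      _ = 0 := by rw [h0, mul_zero, zero_mul]
  exact ⟨s₁, s₂, t₁, t₂, h1.symm, h2.symm, key _ _ _ _ h1 h2 h12, key _ _ _ _ h2 h1 h21⟩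

/-- Given orthogonal idempotents `q i`, each with two orthogonal isometries in its corner, there are
infinitely many orthogonal isometries in each corner, and those of different corners are
orthogonal. -/
theorem exists_orthogonal_isometries {I : Type*} (q : I → A)
    (horth : ∀ i j, i ≠ j → q i * q j = 0)
    (h : ∀ i, ∃ a b a' b' : A, q i * a = a ∧ q i * b = b ∧ a' * q i = a' ∧ b' * q i = b' ∧
      a' * a = q i ∧ b' * b = q i ∧ a' * b = 0 ∧ b' * a = 0) :
    ∃ s t : I → ℕ → A, (∀ i n, t i n * s i n = q i) ∧
      ∀ i j m n, (i, m) ≠ (j, n) → t i m * s j n = 0 := by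
  choose a b a' b' ha hb ha' hb' haa hbb hab hba using h
  -- The isometries in a corner are $a^nb$, with left inverses $b'a'^n$.
  let s : I → ℕ → A := fun i n => n.rec (b i) (fun _ x => a i * x)
  let t : I → ℕ → A := fun i n => n.rec (b' i) (fun _ x => x * a' i)
  have s0 : ∀ i, s i 0 = b i := fun _ => rfl
  have t0 : ∀ i, t i 0 = b' i := fun _ => rfl
  have sS : ∀ i n, s i (n + 1) = a i * s i n := fun _ _ => rfl
  have tS : ∀ i n, t i (n + 1) = t i n * a' i := fun _ _ => rfl
  have qs : ∀ i n, q i * s i n = s i n := by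
    rintro i (_ | n)
    · exact hb i
    · rw [sS, ← mul_assoc, ha]
  have tq : ∀ i n, t i n * q i = t i n := by
    rintro i (_ | n)
    · exact hb' i
    · rw [tS, mul_assoc, ha']
  have hSS : ∀ i m n, t i (m + 1) * s i (n + 1) = t i m * s i n := by
    intro i m n
    rw [sS, tS, mul_assoc, ← mul_assoc (a' i), haa, qs]
  refine ⟨s, t, fun i n => ?_, fun i j m n hne => ?_⟩
  · induction n with
    | zero => exact hbb i
    | succ n ih => rw [hSS, ih]
  · by_cases hij : i = j
    · subst hij
      have hmn : m ≠ n := fun h => hne (by rw [h])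
      clear hne
      induction m generalizing n with
      | zero =>
        obtain _ | n := n
        · exact absurd rfl hmn
        · rw [t0, sS, ← mul_assoc, hba, zero_mul]
      | succ m ih =>
        obtain _ | n := n
        · rw [s0, tS, mul_assoc, hab, mul_zero]
        · rw [hSS]
          exact ih n (fun h => hmn (by rw [h]))
    · rw [← tq, ← qs, mul_assoc, ← mul_assoc (q i), horth i j hij, zero_mul, mul_zero]

/-- The two-sided ideal generated by a family of idempotents, as an additive submonoid. -/
def sandwichIdeal {I : Type*} (q : I → A) : AddSubmonoid A :=
  AddSubmonoid.closure {z | ∃ y i x, z = y * q i * x}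

theorem mul_mem_sandwichIdeal {I : Type*} {q : I → A} {z : A} (hz : z ∈ sandwichIdeal q) (c : A) :
    c * z ∈ sandwichIdeal q := by
  induction hz using AddSubmonoid.closure_induction with
  | mem z hz =>
    obtain ⟨y, i, x, rfl⟩ := hz
    exact AddSubmonoid.subset_closure ⟨c * y, i, x, by simp only [mul_assoc]⟩
  | zero => rw [mul_zero]; exact zero_mem _
  | add x y _ _ hx hy => rw [mul_add]; exact add_mem hx hy

theorem sandwichIdeal_mul_mem {I : Type*} {q : I → A} {z : A} (hz : z ∈ sandwichIdeal q) (c : A) :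
    z * c ∈ sandwichIdeal q := by
  induction hz using AddSubmonoid.closure_induction with
  | mem z hz =>
    obtain ⟨y, i, x, rfl⟩ := hz
    exact AddSubmonoid.subset_closure ⟨y, i, x * c, by simp only [mul_assoc]⟩
  | zero => rw [zero_mul]; exact zero_mem _
  | add x y _ _ hx hy => rw [add_mul]; exact add_mem hx hy

/-- If the identity lies in the ideal generated by a family of idempotents whose corners contain
infinitely many orthogonal isometries, then it is properly infinite. -/
theorem isProperlyInfiniteIdempotent_of_mem_sandwichIdeal {I : Type*} {q : I → A} {u : A}
    (hu : ∀ a : A, u * a = a) (hu' : ∀ a : A, a * u = a) {s t : I → ℕ → A}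
    (hst : ∀ i n, t i n * s i n = q i)
    (hst' : ∀ i j m n, (i, m) ≠ (j, n) → t i m * s j n = 0)
    (hmem : u ∈ sandwichIdeal q) : IsProperlyInfiniteIdempotent u := by
  classical
  obtain ⟨l, hl, hsum⟩ := AddSubmonoid.exists_list_of_mem_closure hmem
  have hl' : ∀ k : Fin l.length, ∃ y i x, l.get k = y * q i * x := fun k => hl _ (l.get_mem k)
  choose y i x hk using hl'
  have hsum' : ∑ k, y k * q (i k) * x k = u := by
    rw [← hsum]
    conv_rhs => rw [← List.ofFn_get l, List.sum_ofFn]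
    exact Finset.sum_congr rfl fun k _ => (hk k).symm
  -- For $c\in\{0,1\}$ the indices $2k+c$ are pairwise distinct, so all cross terms vanish:
  -- $T_cS_c=\sum_k y_kq_{i_k}x_k=u$ and $T_cS_d=0$ for $c\ne d$.
  let S : ℕ → A := fun c => ∑ k, s (i k) (2 * k + c) * x k
  let T : ℕ → A := fun c => ∑ k, y k * t (i k) (2 * k + c)
  have hsame : ∀ c, T c * S c = u := by
    intro c
    rw [Finset.sum_mul, ← hsum']
    refine Finset.sum_congr rfl fun k _ => ?_
    rw [Finset.mul_sum, Finset.sum_eq_single k]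
    · rw [mul_assoc, ← mul_assoc (t _ _), hst, mul_assoc]
    · intro k' _ hne
      rw [mul_assoc, ← mul_assoc (t _ _), hst', zero_mul, mul_zero]
      intro h
      have := (Prod.ext_iff.1 h).2
      exact hne (Fin.ext (by simp at this; omega))
    · simp
  have hdiff : ∀ c d, c < 2 → d < 2 → c ≠ d → T c * S d = 0 := by
    intro c d hc hd hcd
    rw [Finset.sum_mul]
    refine Finset.sum_eq_zero fun k _ => ?_
    rw [Finset.mul_sum]
    refine Finset.sum_eq_zero fun k' _ => ?_
    rw [mul_assoc, ← mul_assoc (t _ _), hst', zero_mul, mul_zero]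
    intro h
    have := (Prod.ext_iff.1 h).2
    simp at this
    omega
  exact isProperlyInfiniteIdempotent_of_isometries hu hu' (hsame 0) (hsame 1)
    (hdiff 0 1 (by norm_num) (by norm_num) (by norm_num))
    (hdiff 1 0 (by norm_num) (by norm_num) (by norm_num))

end ProperlyInfinite

/-! ### Paths and polynomial growth. -/

namespace DirectedGraph

variable {V : Type v} {E : Type w} (G : DirectedGraph V E)

/-- `G.IsPath x l y` says that the list of edges `l` is a path from `x` to `y`. -/
def IsPath : V → List E → V → Prop
  | x, [], y => x = y
  | x, e :: l, y => G.source e = x ∧ IsPath (G.range e) l y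

/-- A vertex is branching if it is the base of two distinct closed paths of the same length. -/
def IsBranching (x : V) : Prop :=
  ∃ l m : List E, l ≠ m ∧ l.length = m.length ∧ G.IsPath x l x ∧ G.IsPath x m x

variable {G}

/-- A path can be cut at its last visit to a given vertex. -/
theorem IsPath.exists_last_visit {x y z : V} {l : List E} (h : G.IsPath y l z) :
    (∀ e ∈ l, G.range e ≠ x) ∨ ∃ l₁ l₂, l = l₁ ++ l₂ ∧ G.IsPath y l₁ x ∧ G.IsPath x l₂ z ∧
      ∀ e ∈ l₂, G.range e ≠ x := by
  induction l generalizing y with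
  | nil => exact Or.inl (by simp)
  | cons e l ih =>
    obtain ⟨he, hl⟩ := h
    rcases ih hl with h | ⟨l₁, l₂, rfl, h₁, h₂, h⟩
    · by_cases hx : G.range e = x
      · exact Or.inr ⟨[e], l, rfl, ⟨he, hx⟩, hx ▸ hl, h⟩
      · exact Or.inl (by simpa using ⟨hx, h⟩)
    · exact Or.inr ⟨e :: l₁, l₂, rfl, ⟨he, h₁⟩, h₂, h⟩

/-- Every path ends with a path of any given smaller length. -/
theorem IsPath.exists_suffix {x z : V} {l : List E} (h : G.IsPath x l z) {n : ℕ}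
    (hn : n ≤ l.length) : ∃ y m, G.IsPath y m z ∧ m.length = n := by
  induction l generalizing x with
  | nil => exact ⟨x, [], h, (Nat.le_zero.1 hn).symm⟩
  | cons e l ih =>
    rcases Nat.lt_or_ge l.length n with h' | h'
    · exact ⟨x, e :: l, h, by simp at hn ⊢; omega⟩
    · exact ih h.2 h'

/-- A set of vertices containing the range of each edge with source in it contains the end of each
path starting in it. -/
theorem IsPath.mem_of_hereditary {H : Set V} (hH : ∀ e, G.source e ∈ H → G.range e ∈ H)
    {x z : V} {l : List E} (h : G.IsPath x l z) (hx : x ∈ H) : z ∈ H := by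
  induction l generalizing x with
  | nil => exact h ▸ hx
  | cons e l ih => exact ih h.2 (hH e (h.1 ▸ hx))

theorem IsPath.notMem_of_hereditary {H : Set V} (hH : ∀ e, G.source e ∈ H → G.range e ∈ H)
    {x z : V} {l : List E} (h : G.IsPath x l z) (hz : z ∉ H) :
    x ∉ H ∧ ∀ e ∈ l, G.source e ∉ H ∧ G.range e ∉ H := by
  refine ⟨fun hx => hz (h.mem_of_hereditary hH hx), ?_⟩
  induction l generalizing x with
  | nil => simp
  | cons e l ih =>
    intro f hf
    rcases List.mem_cons.1 hf with rfl | hf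
    · have : G.range f ∉ H := fun hx => hz (h.2.mem_of_hereditary hH hx)
      exact ⟨fun hs => this (hH f hs), this⟩
    · exact ih h.2 f hf

/-- Paths through non-branching vertices have polynomial growth. -/
theorem exists_finset_paths [DecidableEq V] [DecidableEq E] (S : Finset E) (z : V) (N n : ℕ) :
    ∀ (U : Finset V) (x : V), U.card ≤ n → (∀ y ∈ U, ¬ G.IsBranching y) → x ∈ U →
      ∃ D : Finset (List E), D.card ≤ ((N + 1) * (S.card + 1)) ^ n ∧
        ∀ l : List E, l ⊆ S.toList → G.IsPath x l z → l.length ≤ N → (∀ e ∈ l, G.range e ∈ U) →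
          l ∈ D := by
  induction n with
  | zero =>
    intro U x hU _ hx
    simp at hU
    simp [hU] at hx
  | succ n ih =>
    intro U x hU hB hx
    have hcard : (U.erase x).card ≤ n := by
      rw [Finset.card_erase_of_mem hx]; omega
    have hD : ∀ y : V, ∃ D : Finset (List E), D.card ≤ ((N + 1) * (S.card + 1)) ^ n ∧
        (y ∈ U.erase x → ∀ l : List E, l ⊆ S.toList → G.IsPath y l z → l.length ≤ N →
          (∀ e ∈ l, G.range e ∈ U.erase x) → l ∈ D) := by
      intro y
      by_cases hy : y ∈ U.erase x
      · obtain ⟨D, h₁, h₂⟩ := ih (U.erase x) y hcard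
          (fun y hy => hB y (Finset.mem_of_mem_erase hy)) hy
        exact ⟨D, h₁, fun _ => h₂⟩
      · exact ⟨∅, by simp, fun h => absurd h hy⟩
    choose D hDcard hD using hD
    -- A non-branching vertex has at most one closed path of each length. A path from `x` is thus
    -- determined by the length of its part up to the last visit to `x` and by the remainder, which
    -- is empty or an edge followed by a path in `U.erase x`. This gives one factor $(N+1)(|S|+1)$
    -- per vertex.
    have hc : ∀ t : ℕ, ∃ c : List E, ∀ l, G.IsPath x l x → l.length = t → l = c := by
      intro t
      by_cases h : ∃ c, G.IsPath x c x ∧ c.length = t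
      · obtain ⟨c, hc, hct⟩ := h
        refine ⟨c, fun l hl hlt => ?_⟩
        by_contra hne
        exact hB x hx ⟨l, c, hne, hlt.trans hct.symm, hl, hc⟩
      · exact ⟨[], fun l hl hlt => absurd ⟨l, hl, hlt⟩ h⟩
    choose c hc using hc
    let R : Finset (List E) := {[]} ∪ S.biUnion fun e => (D (G.range e)).image (e :: ·)
    refine ⟨(Finset.range (N + 1)).biUnion fun t => R.image (c t ++ ·), ?_, ?_⟩
    · have hR : R.card ≤ (S.card + 1) * ((N + 1) * (S.card + 1)) ^ n := by
        have h1 : 1 ≤ ((N + 1) * (S.card + 1)) ^ n := Nat.one_le_pow _ _ (by positivity)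
        have h2 : (S.biUnion fun e => (D (G.range e)).image (e :: ·)).card ≤
            S.card * ((N + 1) * (S.card + 1)) ^ n :=
          Finset.card_biUnion_le_card_mul _ _ _ fun e _ => Finset.card_image_le.trans (hDcard _)
        calc R.card ≤ _ := Finset.card_union_le _ _
          _ ≤ 1 + S.card * ((N + 1) * (S.card + 1)) ^ n := by simpa using h2
          _ ≤ _ := by rw [add_mul S.card, one_mul]; omega
      calc _ ≤ (Finset.range (N + 1)).card * ((S.card + 1) * ((N + 1) * (S.card + 1)) ^ n) :=
            Finset.card_biUnion_le_card_mul _ _ _ fun t _ => Finset.card_image_le.trans hR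
        _ = _ := by rw [Finset.card_range]; ring
    · intro l hlS hl hlN hlU
      obtain ⟨l₁, l₂, rfl, h₁, h₂, hx₂⟩ : ∃ l₁ l₂, l = l₁ ++ l₂ ∧ G.IsPath x l₁ x ∧
          G.IsPath x l₂ z ∧ ∀ e ∈ l₂, G.range e ≠ x := by
        rcases hl.exists_last_visit (x := x) with h | h
        · exact ⟨[], l, rfl, rfl, hl, h⟩
        · exact h
      rw [List.length_append] at hlN
      refine Finset.mem_biUnion.2 ⟨l₁.length, Finset.mem_range.2 (by omega),
        Finset.mem_image.2 ⟨l₂, ?_, by rw [← hc _ l₁ h₁ rfl]⟩⟩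
      cases l₂ with
      | nil => simp [R]
      | cons e l =>
        refine Finset.mem_union_right _ (Finset.mem_biUnion.2 ⟨e, ?_,
          Finset.mem_image.2 ⟨l, hD _ ?_ l ?_ h₂.2 ?_ ?_, rfl⟩⟩)
        · exact Finset.mem_toList.1 (hlS (by simp))
        · exact Finset.mem_erase.2 ⟨hx₂ e (by simp), hlU e (by simp)⟩
        · exact fun f hf => hlS (by simp [hf])
        · simp at hlN; omega
        · exact fun f hf => Finset.mem_erase.2 ⟨hx₂ f (by simp [hf]), hlU f (by simp [hf])⟩

end DirectedGraph

/-- A polynomially bounded sequence cannot grow by a fixed factor over steps of fixed length. -/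
theorem exists_le_mul_of_polynomial_growth {d : ℕ → ℕ} (hpos : ∀ n, 0 < d n) {C D : ℕ}
    (hd : ∀ n, d n ≤ C * (n + 1) ^ D) (k N₀ : ℕ) {δ : ℝ} (hδ : 0 < δ) :
    ∃ N, N₀ ≤ N ∧ (d (N + k) : ℝ) ≤ (1 + δ) * d N := by
  by_contra! h
  -- If the conclusion fails from $N_0$ on, the sequence grows exponentially along $N_0+jk$.
  have hgrow : ∀ j : ℕ, (1 + δ) ^ j ≤ (d (N₀ + j * k) : ℝ) := by
    intro j
    induction j with
    | zero => simpa using Nat.one_le_iff_ne_zero.2 (hpos N₀).ne'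
    | succ j ih =>
      have := h (N₀ + j * k) (by omega)
      calc (1 + δ) ^ (j + 1) = (1 + δ) * (1 + δ) ^ j := by ring
        _ ≤ (1 + δ) * d (N₀ + j * k) := by gcongr
        _ ≤ d (N₀ + j * k + k) := this.le
        _ = d (N₀ + (j + 1) * k) := by congr 2; ring
  have hlim : Filter.Tendsto (fun j : ℕ => (j : ℝ) ^ D / (1 + δ) ^ j) Filter.atTop (nhds 0) :=
    tendsto_pow_const_div_const_pow_of_one_lt D (by linarith)
  -- The `+ 1` allows $C=0$. For large $j$ the quantity $j^D$ times this constant is below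
  -- $(1+\delta)^j$, contradicting `hgrow` and the polynomial bound.
  have hB : 0 < (C : ℝ) * (N₀ + k + 1) ^ D + 1 := by positivity
  obtain ⟨j, hj1, hj⟩ := ((Filter.eventually_ge_atTop 1).and
    (hlim.eventually_lt_const (u := 1 / ((C : ℝ) * (N₀ + k + 1) ^ D + 1)) (by positivity))).exists
  have hj1' : (1 : ℝ) ≤ j := by exact_mod_cast hj1
  rw [div_lt_div_iff₀ (by positivity) hB, one_mul] at hj
  have h1 := (hgrow j).trans (Nat.cast_le.2 (hd (N₀ + j * k)))
  push_cast at h1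
  have h2 : (N₀ : ℝ) + j * k + 1 ≤ j * (N₀ + k + 1) := by
    nlinarith [mul_nonneg (sub_nonneg.2 hj1') (Nat.cast_nonneg (α := ℝ) N₀)]
  have h3 : (C : ℝ) * (N₀ + j * k + 1) ^ D ≤ C * (j * (N₀ + k + 1)) ^ D := by gcongr
  have h4 : (0 : ℝ) ≤ j ^ D := by positivity
  rw [mul_pow] at h3
  nlinarith

/-! ### Leavitt families and the ideal of the branching vertices. -/

/-- A family of elements of a ring satisfying the defining relations of the Leavitt path algebra of
`G`. -/
structure LeavittFamily {V : Type v} {E : Type w} (G : DirectedGraph V E) (A : Type*)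
    [NonUnitalRing A] where
  vert : V → A
  edge : E → A
  ghost : E → A
  vert_mul_self : ∀ x, vert x * vert x = vert x
  vert_mul_of_ne : ∀ x y, x ≠ y → vert x * vert y = 0
  source_mul_edge : ∀ e, vert (G.source e) * edge e = edge e
  edge_mul_range : ∀ e, edge e * vert (G.range e) = edge e
  range_mul_ghost : ∀ e, vert (G.range e) * ghost e = ghost e
  ghost_mul_source : ∀ e, ghost e * vert (G.source e) = ghost e
  ghost_mul_edge_self : ∀ e, ghost e * edge e = vert (G.range e)
  ghost_mul_edge_of_ne : ∀ e f, e ≠ f → ghost e * edge f = 0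
  vert_eq_sum : ∀ x (h : G.IsRegular x), vert x = ∑ e ∈ h.finite.toFinset, edge e * ghost e

namespace LeavittFamily

variable {V : Type v} {E : Type w} {G : DirectedGraph V E} {A : Type*} [NonUnitalRing A]
  (F : LeavittFamily G A)

/-- The product of the edges of a list, applied to an element `p`. -/
def path (l : List E) (p : A) : A := l.foldr (fun e a => F.edge e * a) p

/-- The element `p` times the product of the ghost edges of a list in reverse order. -/
def ghostPath (l : List E) (p : A) : A := l.foldr (fun e a => a * F.ghost e) p

@[simp] theorem path_nil (p : A) : F.path [] p = p := rfl
@[simp] theorem path_cons (e : E) (l : List E) (p : A) :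
    F.path (e :: l) p = F.edge e * F.path l p := rfl
@[simp] theorem ghostPath_cons (e : E) (l : List E) (p : A) :
    F.ghostPath (e :: l) p = F.ghostPath l p * F.ghost e := rfl

variable {F}

theorem vert_mul_path {x y : V} {l : List E} {p : A} (hl : G.IsPath x l y)
    (hp : F.vert y * p = p) : F.vert x * F.path l p = F.path l p := by
  cases l with
  | nil => obtain rfl : x = y := hl; exact hp
  | cons e l => rw [path_cons, ← mul_assoc, ← hl.1, F.source_mul_edge]

theorem vert_mul_path_of_ne {x x' y : V} {l : List E} {p : A} (hl : G.IsPath x l y)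
    (hp : F.vert y * p = p) (hx : x' ≠ x) : F.vert x' * F.path l p = 0 := by
  rw [← vert_mul_path hl hp, ← mul_assoc, F.vert_mul_of_ne _ _ hx, zero_mul]

theorem edge_mul_path_of_ne {e : E} {x y : V} {l : List E} {p : A} (hl : G.IsPath x l y)
    (hp : F.vert y * p = p) (hx : G.range e ≠ x) : F.edge e * F.path l p = 0 := by
  rw [← F.edge_mul_range, mul_assoc, vert_mul_path_of_ne hl hp hx, mul_zero]

theorem ghost_mul_path_cons {e : E} {x y : V} {l : List E} {p : A} (hl : G.IsPath x (e :: l) y)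
    (hp : F.vert y * p = p) : F.ghost e * F.path (e :: l) p = F.path l p := by
  rw [path_cons, ← mul_assoc, F.ghost_mul_edge_self, vert_mul_path hl.2 hp]

theorem ghost_mul_path_cons_of_ne {e f : E} {l : List E} {p : A} (h : e ≠ f) :
    F.ghost e * F.path (f :: l) p = 0 := by
  rw [path_cons, ← mul_assoc, F.ghost_mul_edge_of_ne _ _ h, zero_mul]

theorem ghostPath_mul_vert {x y : V} {l : List E} (hl : G.IsPath x l y) :
    F.ghostPath l (F.vert y) * F.vert x = F.ghostPath l (F.vert y) := by
  cases l with
  | nil => obtain rfl : x = y := hl; exact F.vert_mul_self _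
  | cons e l => rw [ghostPath_cons, mul_assoc, ← hl.1, F.ghost_mul_source]

theorem ghostPath_mul_path_self {x y : V} {l : List E} (hl : G.IsPath x l y) :
    F.ghostPath l (F.vert y) * F.path l (F.vert y) = F.vert y := by
  induction l generalizing x with
  | nil => exact F.vert_mul_self _
  | cons e l ih =>
    rw [ghostPath_cons, mul_assoc, ghost_mul_path_cons hl (F.vert_mul_self _), ih hl.2]

/-- Neither path is a proper prefix of the other, so they first differ at edges $e\ne f$, where
$e^*f=0$ applies. -/
theorem ghostPath_mul_path_of_ne {x x' y : V} {l m : List E} (hl : G.IsPath x l y)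
    (hm : G.IsPath x' m y) (hlen : l.length = m.length) (hne : l ≠ m) :
    F.ghostPath l (F.vert y) * F.path m (F.vert y) = 0 := by
  induction l generalizing x x' m with
  | nil => exact absurd (List.length_eq_zero_iff.1 hlen.symm).symm hne
  | cons e l ih =>
    obtain _ | ⟨f, m⟩ := m
    · simp at hlen
    rw [ghostPath_cons, mul_assoc]
    by_cases hef : e = f
    · subst hef
      rw [ghost_mul_path_cons hm (F.vert_mul_self _)]
      exact ih hl.2 hm.2 (by simpa using hlen) (fun h => hne (by rw [h]))
    · rw [ghost_mul_path_cons_of_ne hef, mul_zero]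

variable (F)

/-- The ideal generated by the branching vertices, as an additive submonoid. -/
def branchingIdeal : AddSubmonoid A :=
  sandwichIdeal fun x : {x // G.IsBranching x} => F.vert x

/-- The set of vertices in the ideal generated by the branching vertices. -/
def branchingHull : Set V := {x | F.vert x ∈ F.branchingIdeal}

variable {F}

theorem mem_branchingHull_of_isBranching {x : V} (hx : G.IsBranching x) : x ∈ F.branchingHull :=
  AddSubmonoid.subset_closure ⟨F.vert x, ⟨x, hx⟩, F.vert x, by simp only [F.vert_mul_self]⟩

/-- This is $r(e)=e^*s(e)e$. -/
theorem range_mem_branchingHull (e : E) (h : G.source e ∈ F.branchingHull) :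
    G.range e ∈ F.branchingHull := by
  change F.vert _ ∈ F.branchingIdeal
  rw [← F.ghost_mul_edge_self, ← F.source_mul_edge]
  exact mul_mem_sandwichIdeal (sandwichIdeal_mul_mem h _) _

/-- This is $x=\sum e\,r(e)\,e^*$. -/
theorem mem_branchingHull_of_isRegular {x : V} (hx : G.IsRegular x)
    (h : ∀ e, G.source e = x → G.range e ∈ F.branchingHull) : x ∈ F.branchingHull := by
  change F.vert _ ∈ F.branchingIdeal
  rw [F.vert_eq_sum x hx]
  refine sum_mem fun e he => ?_
  rw [← F.edge_mul_range]
  exact sandwichIdeal_mul_mem (mul_mem_sandwichIdeal (h e (by simpa using he)) _) _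

theorem isProperlyInfiniteIdempotent_of_branchingHull_eq_univ [Fintype V]
    (hu : ∀ a : A, (∑ x, F.vert x) * a = a ∧ a * (∑ x, F.vert x) = a)
    (hH : ∀ x, x ∈ F.branchingHull) : IsProperlyInfiniteIdempotent (∑ x, F.vert x) := by
  obtain ⟨s, t, hst, hst'⟩ := exists_orthogonal_isometries
    (fun x : {x // G.IsBranching x} => F.vert x)
    (fun x y hxy => F.vert_mul_of_ne _ _ (fun h => hxy (Subtype.ext h))) (by
      rintro ⟨x, l, m, hne, hlen, hl, hm⟩
      exact ⟨F.path l (F.vert x), F.path m (F.vert x), F.ghostPath l (F.vert x),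
        F.ghostPath m (F.vert x), vert_mul_path hl (F.vert_mul_self _),
        vert_mul_path hm (F.vert_mul_self _), ghostPath_mul_vert hl, ghostPath_mul_vert hm,
        ghostPath_mul_path_self hl, ghostPath_mul_path_self hm,
        ghostPath_mul_path_of_ne hl hm hlen hne, ghostPath_mul_path_of_ne hm hl hlen.symm hne.symm⟩)
  exact isProperlyInfiniteIdempotent_of_mem_sandwichIdeal (fun a => (hu a).1) (fun a => (hu a).2)
    hst hst' (sum_mem fun x _ => hH x)

/-- If all vertices outside the branching hull are regular, then there are paths of any length from
one of them to a fixed one. -/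
theorem exists_vertex_arbitrarily_long_paths [Finite V] (hH : ∃ x, x ∉ F.branchingHull)
    (hreg : ∀ x, x ∉ F.branchingHull → G.IsRegular x) :
    ∃ y, y ∉ F.branchingHull ∧ ∀ n, ∃ x l, G.IsPath x l y ∧ l.length = n := by
  have hstep : ∀ n x, x ∉ F.branchingHull → ∃ y l, y ∉ F.branchingHull ∧ G.IsPath x l y ∧
      l.length = n := by
    intro n
    induction n with
    | zero => exact fun x hx => ⟨x, [], hx, rfl, rfl⟩
    | succ n ih =>
      intro x hx
      obtain ⟨e, he, hr⟩ : ∃ e, G.source e = x ∧ G.range e ∉ F.branchingHull := by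
        by_contra! h
        exact hx (mem_branchingHull_of_isRegular (hreg x hx) h)
      obtain ⟨y, l, hy, hl, hlen⟩ := ih _ hr
      exact ⟨y, e :: l, hy, ⟨he, hl⟩, by simp [hlen]⟩
  obtain ⟨x, hx⟩ := hH
  choose y l hy hl hlen using fun n => hstep n x hx
  -- The endpoints depend on the length; by pigeonhole one vertex ends arbitrarily long paths, and
  -- their suffixes give every length.
  obtain ⟨z, hz⟩ := Finite.exists_infinite_fiber y
  have hz := Set.infinite_coe_iff.1 hz
  refine ⟨z, ?_, fun n => ?_⟩
  · obtain ⟨m, hm⟩ := hz.nonempty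
    exact hm ▸ hy m
  · obtain ⟨m, hm, hnm⟩ := hz.exists_gt n
    exact (hm ▸ hl m : G.IsPath x (l m) z).exists_suffix (by rw [hlen]; exact hnm.le)

/-- At a vertex that is not regular, finitely many ghost edges have a common nonzero right
annihilator. -/
theorem exists_ne_zero_ghost_mul_eq_zero (hne : ∀ x, F.vert x ≠ 0) (hy : ¬ G.IsRegular y)
    (S : Finset E) : ∃ p : A, p ≠ 0 ∧ F.vert y * p = p ∧ ∀ e ∈ S, F.ghost e * p = 0 := by
  classical
  -- With $R$ the edges of `S` leaving $y$, take $p=y-\sum_{f\in R}ff^*$. It is $y$ itself at a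
  -- sink; at an infinite emitter some edge $e\notin R$ has $e^*p=e^*\neq0$.
  let R : Finset E := S.filter (G.source · = y)
  have hR : ∀ e ∈ R, G.source e = y := fun e he => (Finset.mem_filter.1 he).2
  have hghost : ∀ e, G.source e = y → F.ghost e * (F.vert y - ∑ f ∈ R, F.edge f * F.ghost f) =
      if e ∈ R then 0 else F.ghost e := by
    rintro e rfl
    rw [mul_sub, F.ghost_mul_source, Finset.mul_sum]
    split_ifs with he
    · rw [Finset.sum_eq_single e, ← mul_assoc, F.ghost_mul_edge_self, F.range_mul_ghost, sub_self]
      · intro f _ hf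
        rw [← mul_assoc, F.ghost_mul_edge_of_ne _ _ hf.symm, zero_mul]
      · exact fun h => absurd he h
    · rw [Finset.sum_eq_zero, sub_zero]
      intro f hf
      rw [← mul_assoc, F.ghost_mul_edge_of_ne, zero_mul]
      rintro rfl
      exact he hf
  refine ⟨F.vert y - ∑ f ∈ R, F.edge f * F.ghost f, ?_, ?_, fun e he => ?_⟩
  · by_cases hsink : ∃ e, G.source e = y
    · have hinf : (G.source ⁻¹' {y}).Infinite := fun h => hy ⟨h, hsink⟩
      obtain ⟨e, hey, heR⟩ := hinf.exists_notMem_finset R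
      intro h0
      have := hghost e hey
      rw [h0, mul_zero, if_neg heR] at this
      exact hne (G.range e) (by rw [← F.ghost_mul_edge_self, ← this, zero_mul])
    · have : R = ∅ := Finset.eq_empty_of_forall_notMem fun e he => hsink ⟨e, hR e he⟩
      rw [this, Finset.sum_empty, sub_zero]
      exact hne y
  · rw [mul_sub, F.vert_mul_self, Finset.mul_sum]
    congr 1
    refine Finset.sum_congr rfl fun f hf => ?_
    rw [← mul_assoc, ← hR f hf, F.source_mul_edge]
  · by_cases hey : G.source e = y
    · rw [hghost e hey, if_pos (Finset.mem_filter.2 ⟨he, hey⟩)]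
    · rw [mul_sub, Finset.mul_sum, ← F.ghost_mul_source, mul_assoc, F.vert_mul_of_ne _ _ hey,
        mul_zero, Finset.sum_eq_zero, sub_zero]
      intro f hf
      rw [mul_assoc, ← mul_assoc (F.vert _), ← F.source_mul_edge f, ← mul_assoc (F.vert _),
        hR f hf, F.vert_mul_of_ne _ _ hey, zero_mul, zero_mul, mul_zero]

end LeavittFamily

/-! ### A graded representation on a free module. -/

/-- The linear endomorphism of a free module induced by a partial map of its basis. -/
noncomputable def partialEnd (K : Type*) {X : Type*} [Field K] (τ : X → Option X) :
    Module.End K (X →₀ K) :=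
  Finsupp.lsum K fun x => (τ x).elim 0 fun y => Finsupp.lsingle y

section PartialEnd

variable {K X : Type*} [Field K]

theorem partialEnd_single_of_none {τ : X → Option X} {x : X} (h : τ x = none) (c : K) :
    partialEnd K τ (Finsupp.single x c) = 0 := by
  simp [partialEnd, h]

theorem partialEnd_single_of_some {τ : X → Option X} {x y : X} (h : τ x = some y) (c : K) :
    partialEnd K τ (Finsupp.single x c) = Finsupp.single y c := by
  simp [partialEnd, h]

theorem partialEnd_mul (τ σ : X → Option X) :
    partialEnd K τ * partialEnd K σ = partialEnd K fun x => (σ x).bind τ := by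
  refine Finsupp.lhom_ext fun x c => ?_
  rw [Module.End.mul_apply]
  cases h : σ x with
  | none => rw [partialEnd_single_of_none h, map_zero, partialEnd_single_of_none (by simp [h])]
  | some y =>
    rw [partialEnd_single_of_some h]
    cases h' : τ y with
    | none => rw [partialEnd_single_of_none h', partialEnd_single_of_none (by simp [h, h'])]
    | some z => rw [partialEnd_single_of_some h', partialEnd_single_of_some (by simpa [h] using h')]

theorem partialEnd_eq_zero {τ : X → Option X} (h : ∀ x, τ x = none) : partialEnd K τ = 0 :=
  Finsupp.lhom_ext fun x c => by rw [partialEnd_single_of_none (h x)]; rfl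

end PartialEnd

namespace DirectedGraph

variable {V : Type v} {E : Type w} (G : DirectedGraph V E)

/-- There is a set `κ` with partial bijections from `E × κ` to `V × κ` over the source map that are
defined on all of `E × κ` and reach every vertex that is not a sink. -/
theorem exists_branching_system : ∃ (κ : Type w) (_ : Nonempty κ) (f : E → κ → κ)
    (d : V → κ → Option (E × κ)), (∀ e k, d (G.source e) (f e k) = some (e, k)) ∧
      (∀ x k e k', d x k = some (e, k') → G.source e = x ∧ f e k' = k) ∧
      ∀ e k, d (G.source e) k ≠ none := by
  classical
  -- For infinite $\kappa$ with $|\kappa|\ge|E|$, cardinal arithmetic gives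
  -- $s^{-1}(x)\times\kappa\simeq\kappa$ at every vertex $x$ that is not a sink.
  obtain ⟨κ, h1, h2⟩ : ∃ κ : Type w, Cardinal.aleph0 ≤ Cardinal.mk κ ∧
      Cardinal.mk E ≤ Cardinal.mk κ :=
    ⟨ℕ ⊕ E, Cardinal.aleph0_le_mk _, Cardinal.mk_le_of_injective Sum.inr_injective⟩
  have hκ : Nonempty κ := Cardinal.mk_ne_zero_iff.1 (Cardinal.aleph0_pos.trans_le h1).ne'
  have hφ : ∀ x, (∃ e, G.source e = x) → Nonempty ({e // G.source e = x} × κ ≃ κ) := by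
    rintro x ⟨e, he⟩
    refine Cardinal.eq.1 ?_
    rw [Cardinal.mk_prod, Cardinal.lift_id, Cardinal.lift_id]
    exact Cardinal.mul_eq_right h1 ((Cardinal.mk_subtype_le _).trans h2)
      (Cardinal.mk_ne_zero_iff.2 ⟨⟨e, he⟩⟩)
  let φ : ∀ x, (∃ e, G.source e = x) → ({e // G.source e = x} × κ ≃ κ) := fun x h => (hφ x h).some
  refine ⟨κ, hκ, fun e k => φ (G.source e) ⟨e, rfl⟩ (⟨e, rfl⟩, k),
    fun x k => if h : ∃ e, G.source e = x then
      some (((φ x h).symm k).1.1, ((φ x h).symm k).2) else none, ?_, ?_, ?_⟩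
  · intro e k
    beta_reduce
    rw [dif_pos ⟨e, rfl⟩, Equiv.symm_apply_apply]
  · intro x k e k' h
    beta_reduce at h ⊢
    by_cases hx : ∃ e, G.source e = x
    · rw [dif_pos hx] at h
      obtain ⟨rfl, rfl⟩ : ((φ x hx).symm k).1.1 = e ∧ ((φ x hx).symm k).2 = k' := by
        simpa using h
      -- Letting the vertex vary avoids transporting `φ` along $s(e)=x$.
      have key : ∀ y (hy : y = x) (h' : ∃ e, G.source e = y)
          (q : G.source ((φ x hx).symm k).1.1 = y), φ y h' (⟨_, q⟩, ((φ x hx).symm k).2) = k := by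
        rintro y rfl h' q
        exact (φ y hx).apply_symm_apply k
      exact ⟨((φ x hx).symm k).1.2, key _ ((φ x hx).symm k).1.2 ⟨_, rfl⟩ rfl⟩
    · rw [dif_neg hx] at h
      cases h
  · intro e k
    beta_reduce
    rw [dif_pos ⟨e, rfl⟩]
    simp

end DirectedGraph

namespace LeavittPath

variable {K : Type u} {V : Type v} {E : Type w} [Field K] (G : DirectedGraph V E)

/-- The presented algebra acts on a vector space so that each path of length `n` from `x` to `y`
sends one fixed nonzero vector at `y` to a basis vector of degree `n` at `x`. -/
theorem exists_graded_representation : ∃ (κ : Type w) (_ : Nonempty κ) (f : E → κ → κ)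
    (ρ : Unitized K G →ₐ[K] Module.End K (V × κ × ℤ →₀ K)),
    (∀ x k n, ρ (gen K G (.vertex x)) (Finsupp.single (x, k, n) 1) = Finsupp.single (x, k, n) 1) ∧
    ∀ e k n, ρ (gen K G (.edge e)) (Finsupp.single (G.range e, k, n) 1) =
      Finsupp.single (G.source e, f e k, n + 1) 1 := by
  classical
  obtain ⟨κ, hκ, f, d, hdf, hd, hd'⟩ := G.exists_branching_system
  -- The $\mathbb{Z}$-coordinate is a degree: edges raise it by one, ghost edges lower it by one and
  -- vertices preserve it.
  let X := V × κ × ℤ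
  let vτ : V → X → Option X := fun x p => if p.1 = x then some p else none
  let eτ : E → X → Option X := fun e p =>
    if p.1 = G.range e then some (G.source e, f e p.2.1, p.2.2 + 1) else none
  let gτ : E → X → Option X := fun e p => (d p.1 p.2.1).bind fun q =>
    if q.1 = e then some (G.range e, q.2, p.2.2 - 1) else none
  have gτ_self : ∀ e k n, gτ e (G.source e, f e k, n) = some (G.range e, k, n - 1) := by
    intro e k n
    simp [gτ, hdf]
  have gτ_ne : ∀ e e' k n, e ≠ e' → gτ e (G.source e', f e' k, n) = none := by
    intro e e' k n h
    simp [gτ, hdf, h.symm]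
  have gτ_cases : ∀ e p, gτ e p = none ∨ ∃ k, p = (G.source e, f e k, p.2.2) := by
    rintro e ⟨x, k, n⟩
    cases h : d x k with
    | none => left; simp [gτ, h]
    | some q =>
      obtain ⟨e', k'⟩ := q
      by_cases he : e' = e
      · subst he
        obtain ⟨rfl, rfl⟩ := hd _ _ _ _ h
        exact Or.inr ⟨k', rfl⟩
      · left; simp [gτ, h, he]
  have eτ_range : ∀ e k n, eτ e (G.range e, k, n) = some (G.source e, f e k, n + 1) := by
    intro e k n
    simp [eτ]
  have eτ_ne : ∀ e p, p.1 ≠ G.range e → eτ e p = none := fun e p h => if_neg h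
  have vτ_self : ∀ p : X, vτ p.1 p = some p := fun p => if_pos rfl
  have vτ_ne : ∀ x (p : X), p.1 ≠ x → vτ x p = none := fun x p h => if_neg h
  let τ : Gen V E → X → Option X := fun g => Gen.casesOn g vτ eτ gτ
  let ρ₀ : FreeAlgebra K (Gen V E) →ₐ[K] Module.End K (X →₀ K) :=
    FreeAlgebra.lift K fun g => partialEnd K (τ g)
  have hv : ∀ x, ρ₀ (fv K x) = partialEnd K (vτ x) := fun x => FreeAlgebra.lift_ι_apply _ _
  have he : ∀ e, ρ₀ (fe K e) = partialEnd K (eτ e) := fun x => FreeAlgebra.lift_ι_apply _ _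
  have hg : ∀ e, ρ₀ (fg K e) = partialEnd K (gτ e) := fun x => FreeAlgebra.lift_ι_apply _ _
  have hrel : ∀ ⦃a b⦄, Rel K G a b → ρ₀ a = ρ₀ b := by
    intro a b hab
    cases hab with
    | vertex_idem x =>
      rw [map_mul, hv, partialEnd_mul]
      congr 1; funext p
      by_cases hp : p.1 = x
      · subst hp; simp [vτ_self]
      · simp [vτ_ne x p hp]
    | vertex_orth x y h =>
      rw [map_mul, hv, hv, partialEnd_mul, map_zero]
      refine partialEnd_eq_zero fun p => ?_
      by_cases hp : p.1 = y
      · subst hp; simpa [vτ_self] using vτ_ne x p h.symm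
      · simp [vτ_ne y p hp]
    | source_edge e =>
      rw [map_mul, hv, he, partialEnd_mul]
      congr 1; funext p
      by_cases hp : p.1 = G.range e
      · obtain ⟨x, k, n⟩ := p
        obtain rfl : x = _ := hp
        simpa [eτ_range] using vτ_self (G.source e, f e k, n + 1)
      · simp [eτ_ne e p hp]
    | edge_range e =>
      rw [map_mul, hv, he, partialEnd_mul]
      congr 1; funext p
      by_cases hp : p.1 = G.range e
      · rw [← hp, vτ_self]; simp
      · simp [eτ_ne e p hp, vτ_ne _ p hp]
    | range_ghost e =>
      rw [map_mul, hv, hg, partialEnd_mul]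
      congr 1; funext p
      rcases gτ_cases e p with h | ⟨k, h⟩
      · simp [h]
      · rw [h, gτ_self]; exact vτ_self (G.range e, k, p.2.2 - 1)
    | ghost_source e =>
      rw [map_mul, hv, hg, partialEnd_mul]
      congr 1; funext p
      rcases gτ_cases e p with h | ⟨k, h⟩
      · by_cases hp : p.1 = G.source e
        · rw [← hp, vτ_self]; simp
        · simp [h, vτ_ne _ p hp]
      · rw [h]; exact (congrArg (fun o => o.bind (gτ e)) (vτ_self (G.source e, f e k, p.2.2)))
    | ck1_same e =>
      rw [map_mul, hv, he, hg, partialEnd_mul]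
      congr 1; funext p
      by_cases hp : p.1 = G.range e
      · obtain ⟨x, k, n⟩ := p
        obtain rfl : x = _ := hp
        simp only [eτ_range, Option.bind_some, gτ_self, add_sub_cancel_right]
        exact (vτ_self (G.range e, k, n)).symm
      · simp [eτ_ne e p hp, vτ_ne _ p hp]
    | ck1_ne e e' h =>
      rw [map_mul, he, hg, partialEnd_mul, map_zero]
      refine partialEnd_eq_zero fun p => ?_
      by_cases hp : p.1 = G.range e'
      · obtain ⟨x, k, n⟩ := p
        obtain rfl : x = _ := hp
        simpa only [eτ_range, Option.bind_some] using gτ_ne _ _ _ _ h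
      · simp [eτ_ne e' p hp]
    | ck2 x h =>
      rw [hv, map_sum]
      refine Finsupp.lhom_ext fun p c => ?_
      rw [LinearMap.sum_apply]
      simp only [map_mul, he, hg, partialEnd_mul]
      by_cases hp : p.1 = x
      · obtain ⟨y, k, n⟩ := p
        obtain rfl : y = x := hp
        obtain ⟨e₀, he₀⟩ : ∃ e, G.source e = y := h.nonempty
        -- Exactly one edge `e` has $k$ in the image of its map, so a single summand $ee^*$ acts
        -- nontrivially on this basis vector.
        obtain ⟨⟨e, k'⟩, hek⟩ := Option.ne_none_iff_exists'.1 (hd' e₀ k)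
        rw [he₀] at hek
        obtain ⟨rfl, rfl⟩ := hd _ _ _ _ hek
        rw [partialEnd_single_of_some (vτ_self (_, f e k', n)), Finset.sum_eq_single e,
          partialEnd_single_of_some]
        · rw [gτ_self, Option.bind_some, eτ_range, sub_add_cancel]
        · intro e' _ hne
          exact partialEnd_single_of_none (by rw [gτ_ne _ _ _ _ hne]; rfl) _
        · intro hmem
          simp at hmem
      · rw [partialEnd_single_of_none (vτ_ne _ _ hp), Finset.sum_eq_zero]
        intro e hmem
        refine partialEnd_single_of_none ?_ _
        rcases gτ_cases e p with h' | ⟨k, h'⟩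
        · rw [h']; rfl
        · exact absurd (by rw [h']; simpa using hmem) hp
  refine ⟨κ, hκ, f, RingQuot.liftAlgHom K ⟨ρ₀, hrel⟩, fun x k n => ?_, fun e k n => ?_⟩
  · rw [gen, RingQuot.liftAlgHom_mkAlgHom_apply, hv, partialEnd_single_of_some (vτ_self (x, k, n))]
  · rw [gen, RingQuot.liftAlgHom_mkAlgHom_apply, he, partialEnd_single_of_some (eτ_range _ _ _)]

end LeavittPath

/-! ### Følner subspaces spanned by paths. -/

namespace LeavittFamily

variable (K : Type*) [Field K] {V : Type v} {E : Type w} {G : DirectedGraph V E} {A : Type*}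
  [NonUnitalRing A] [Module K A] (F : LeavittFamily G A)

/-- The span of the elements given by paths to `y` with edges in `S` and with length between `M` and
`N`, applied to `p`. -/
def pathSpan (S : Finset E) (y : V) (p : A) (M N : ℕ) : Submodule K A :=
  Submodule.span K {z | ∃ x l, G.IsPath x l y ∧ l ⊆ S.toList ∧ M ≤ l.length ∧ l.length ≤ N ∧
    F.path l p = z}

variable {K F} {S : Finset E} {y : V} {p : A}

theorem path_mem_pathSpan {x : V} {l : List E} {M N : ℕ} (hl : G.IsPath x l y)
    (hS : l ⊆ S.toList) (hM : M ≤ l.length) (hN : l.length ≤ N) :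
    F.path l p ∈ F.pathSpan K S y p M N :=
  Submodule.subset_span ⟨x, l, hl, hS, hM, hN, rfl⟩

theorem pathSpan_mono {M M' N N' : ℕ} (hM : M' ≤ M) (hN : N ≤ N') :
    F.pathSpan K S y p M N ≤ F.pathSpan K S y p M' N' := by
  refine Submodule.span_mono ?_
  rintro _ ⟨x, l, hl, hS, h₁, h₂, rfl⟩
  exact ⟨x, l, hl, hS, hM.trans h₁, h₂.trans hN, rfl⟩

/-- For fixed `k`, discarding the short paths costs a dimension bounded independently of `N`. -/
theorem pathSpan_le_sup (k N : ℕ) :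
    F.pathSpan K S y p 0 N ≤ F.pathSpan K S y p 0 k ⊔ F.pathSpan K S y p k N := by
  refine Submodule.span_le.2 ?_
  rintro _ ⟨x, l, hl, hS, h₁, h₂, rfl⟩
  rcases le_total l.length k with h | h
  · exact Submodule.mem_sup_left (path_mem_pathSpan hl hS h₁ h)
  · exact Submodule.mem_sup_right (path_mem_pathSpan hl hS h h₂)

/-- The hull is hereditary, so paths ending outside it use only non-branching vertices and
`exists_finset_paths` counts them. -/
theorem exists_finset_pathSpan_le [Fintype V] (hy : y ∉ F.branchingHull) (N : ℕ) :
    ∃ D : Finset A, D.card ≤ Fintype.card V * (S.card + 1) ^ Fintype.card V *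
        (N + 1) ^ Fintype.card V ∧ F.pathSpan K S y p 0 N ≤ Submodule.span K D := by
  classical
  let U : Finset V := Finset.univ.filter (· ∉ F.branchingHull)
  have hD : ∀ x : V, ∃ D : Finset (List E),
      D.card ≤ ((N + 1) * (S.card + 1)) ^ Fintype.card V ∧ ∀ l : List E, l ⊆ S.toList →
        G.IsPath x l y → l.length ≤ N → l ∈ D := by
    intro x
    by_cases hx : x ∈ F.branchingHull
    · exact ⟨∅, by simp, fun l _ hl =>
        absurd (hl.mem_of_hereditary range_mem_branchingHull hx) hy⟩
    · obtain ⟨D, h₁, h₂⟩ := G.exists_finset_paths S y N (Fintype.card V) U x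
        (Finset.card_le_univ _)
        (fun z hz hz' => (Finset.mem_filter.1 hz).2 (mem_branchingHull_of_isBranching hz'))
        (by simpa [U] using hx)
      refine ⟨D, h₁, fun l hS hl hN => h₂ l hS hl hN fun e he => ?_⟩
      simpa [U] using ((hl.notMem_of_hereditary range_mem_branchingHull hy).2 e he).2
  choose D hcard hD using hD
  refine ⟨(Finset.univ.biUnion D).image (F.path · p), ?_, ?_⟩
  · calc _ ≤ _ := Finset.card_image_le
      _ ≤ Fintype.card V * ((N + 1) * (S.card + 1)) ^ Fintype.card V :=
        Finset.card_biUnion_le_card_mul _ _ _ fun x _ => hcard x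
      _ = _ := by rw [mul_pow]; ring
  · refine Submodule.span_mono ?_
    rintro _ ⟨x, l, hl, hS, -, h₂, rfl⟩
    simp only [Finset.coe_image, Set.mem_image]
    exact ⟨l, Finset.mem_coe.2 (Finset.mem_biUnion.2 ⟨x, Finset.mem_univ _, hD x l hS hl h₂⟩), rfl⟩

theorem finiteDimensional_pathSpan [Fintype V] (hy : y ∉ F.branchingHull) (M N : ℕ) :
    FiniteDimensional K (F.pathSpan K S y p M N) := by
  obtain ⟨D, -, hD⟩ := exists_finset_pathSpan_le (K := K) (S := S) (p := p) hy N
  exact Submodule.finiteDimensional_of_le ((pathSpan_mono (Nat.zero_le M) le_rfl).trans hD)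

theorem finrank_pathSpan_le [Fintype V] (hy : y ∉ F.branchingHull) (N : ℕ) :
    Module.finrank K (F.pathSpan K S y p 0 N) ≤
      Fintype.card V * (S.card + 1) ^ Fintype.card V * (N + 1) ^ Fintype.card V := by
  obtain ⟨D, h, hD⟩ := exists_finset_pathSpan_le (K := K) (S := S) (p := p) hy N
  exact (Submodule.finrank_mono hD).trans ((finrank_span_finset_le_card D).trans h)

variable (K F) in
/-- Left multiplication by `a` changes the length of paths by at most `k`, except possibly for paths
shorter than `k` in the case that ghost edges do not annihilate `p`. -/
def ShiftsBy (S : Finset E) (y : V) (p a : A) (k : ℕ) : Prop :=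
  ∀ M N, ((∀ e ∈ S, F.ghost e * p = 0) ∨ k ≤ M) → ∀ z ∈ F.pathSpan K S y p M N,
    a * z ∈ F.pathSpan K S y p (M - k) (N + k)

theorem ShiftsBy.mono {a : A} {k k' : ℕ} (h : F.ShiftsBy K S y p a k) (hk : k ≤ k') :
    F.ShiftsBy K S y p a k' := fun M N hM z hz =>
  pathSpan_mono (by omega) (by omega) (h M N (hM.imp_right hk.trans) z hz)

theorem ShiftsBy.add {a b : A} {k m : ℕ} (ha : F.ShiftsBy K S y p a k)
    (hb : F.ShiftsBy K S y p b m) : F.ShiftsBy K S y p (a + b) (k + m) := fun M N hM z hz => by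
  rw [add_mul]
  exact add_mem (ha.mono (Nat.le_add_right k m) M N hM z hz)
    (hb.mono (Nat.le_add_left m k) M N hM z hz)

/-- From length at least $k+m$, the factor `b` leaves length at least $k$, so `a` may still act. -/
theorem ShiftsBy.mul {a b : A} {k m : ℕ} (ha : F.ShiftsBy K S y p a k)
    (hb : F.ShiftsBy K S y p b m) : F.ShiftsBy K S y p (a * b) (k + m) := fun M N hM z hz => by
  rw [mul_assoc]
  exact pathSpan_mono (by omega) (by omega) (ha _ _ (hM.imp_right fun h => by omega) _
    (hb M N (hM.imp_right fun h => by omega) z hz))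

variable [SMulCommClass K A A]

theorem ShiftsBy.of_path {a : A} {k : ℕ}
    (h : ∀ x l, G.IsPath x l y → l ⊆ S.toList → ((∀ e ∈ S, F.ghost e * p = 0) ∨ k ≤ l.length) →
      a * F.path l p ∈ F.pathSpan K S y p (l.length - k) (l.length + k)) :
    F.ShiftsBy K S y p a k := by
  intro M N hM
  suffices F.pathSpan K S y p M N ≤
      (F.pathSpan K S y p (M - k) (N + k)).comap (LinearMap.mulLeft K a) from fun z hz => this hz
  refine Submodule.span_le.2 ?_
  rintro _ ⟨x, l, hl, hS, h₁, h₂, rfl⟩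
  exact pathSpan_mono (Nat.sub_le_sub_right h₁ k) (Nat.add_le_add_right h₂ k)
    (h x l hl hS (hM.imp_right fun h => h.trans h₁))

theorem shiftsBy_vert (hp : F.vert y * p = p) (x : V) : F.ShiftsBy K S y p (F.vert x) 0 := by
  refine .of_path fun x' l hl hS _ => ?_
  by_cases hx : x = x'
  · rw [hx, vert_mul_path hl hp]
    exact path_mem_pathSpan hl hS le_rfl le_rfl
  · rw [vert_mul_path_of_ne hl hp hx]
    exact zero_mem _

theorem shiftsBy_edge (hp : F.vert y * p = p) {e : E} (he : e ∈ S) :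
    F.ShiftsBy K S y p (F.edge e) 1 := by
  refine .of_path fun x l hl hS _ => ?_
  by_cases hx : G.range e = x
  · exact path_mem_pathSpan (l := e :: l) (x := G.source e) ⟨rfl, hx ▸ hl⟩
      (List.cons_subset.2 ⟨Finset.mem_toList.2 he, hS⟩) (by simp; omega) (by simp)
  · rw [edge_mul_path_of_ne hl hp hx]
    exact zero_mem _

theorem shiftsBy_ghost (hp : F.vert y * p = p) {e : E} (he : e ∈ S) :
    F.ShiftsBy K S y p (F.ghost e) 1 := by
  refine .of_path fun x l hl hS hk => ?_
  cases l with
  | nil =>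
    rcases hk with h | h
    · rw [path_nil, h e he]; exact zero_mem _
    · simp at h
  | cons f l =>
    by_cases hef : e = f
    · subst hef
      rw [ghost_mul_path_cons hl hp]
      exact path_mem_pathSpan hl.2 (List.cons_subset.1 hS).2 (by simp) (by simp; omega)
    · rw [ghost_mul_path_cons_of_ne hef]
      exact zero_mem _

/-- Spans of paths to a vertex outside the branching hull contain Følner subspaces. -/
theorem exists_folner [Fintype V] (hy : y ∉ F.branchingHull) (hp : p ≠ 0) {T : Finset A} {k : ℕ}
    (hT : ∀ a ∈ T, F.ShiftsBy K S y p a k)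
    (h : (∀ e ∈ S, F.ghost e * p = 0) ∨ ∀ N, N < Module.finrank K (F.pathSpan K S y p 0 N))
    {ε : ℝ} (hε : 0 < ε) :
    ∃ W : Submodule K A, W ≠ ⊥ ∧ FiniteDimensional K W ∧ ∀ a ∈ T,
      (Module.finrank K ↥(W.map (LinearMap.mulLeft K a) ⊔ W) : ℝ) / (Module.finrank K W : ℝ)
        ≤ 1 + ε := by
  have hfin : ∀ M N, FiniteDimensional K (F.pathSpan K S y p M N) :=
    finiteDimensional_pathSpan hy
  have hmem : ∀ N, p ∈ F.pathSpan K S y p 0 N := fun N =>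
    path_mem_pathSpan (l := []) (x := y) rfl (by simp) le_rfl (Nat.zero_le _)
  have hpos : ∀ N, 0 < Module.finrank K (F.pathSpan K S y p 0 N) := fun N => by
    have : Nontrivial (F.pathSpan K S y p 0 N) :=
      Submodule.nontrivial_iff_ne_bot.2 (Submodule.ne_bot_iff _ |>.2 ⟨p, hmem N, hp⟩)
    exact Module.finrank_pos
  -- For $W$ the span of the paths with lengths in $[M,N]$, every $aW+W$ lies in the span for
  -- $[0,N+k]$.
  suffices ∃ M N, ((∀ e ∈ S, F.ghost e * p = 0) ∨ k ≤ M) ∧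
      0 < Module.finrank K (F.pathSpan K S y p M N) ∧
      (Module.finrank K (F.pathSpan K S y p 0 (N + k)) : ℝ) ≤
        (1 + ε) * Module.finrank K (F.pathSpan K S y p M N) by
    obtain ⟨M, N, hM, hW, hle⟩ := this
    refine ⟨F.pathSpan K S y p M N, ?_, hfin M N, fun a ha => ?_⟩
    · intro h0
      rw [h0, finrank_bot] at hW
      exact lt_irrefl _ hW
    · rw [div_le_iff₀ (by exact_mod_cast hW)]
      refine le_trans (Nat.cast_le.2 (Submodule.finrank_mono (sup_le ?_ ?_))) hle
      · rintro _ ⟨z, hz, rfl⟩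
        exact pathSpan_mono (Nat.zero_le _) le_rfl (hT a ha M N hM z hz)
      · exact pathSpan_mono (Nat.zero_le _) (Nat.le_add_right _ _)
  rcases h with h | h
  · obtain ⟨N, -, hN⟩ := exists_le_mul_of_polynomial_growth hpos (finrank_pathSpan_le hy) k 0 hε
    exact ⟨0, N, Or.inl h, hpos N, hN⟩
  -- Half of $\varepsilon$ is spent on growth from $N$ to $N+k$. The other half pays for dropping
  -- paths shorter than $k$: $N_0$ makes $(1+\varepsilon)$ times the dimension for $[0,k]$ less than
  -- $\varepsilon/2$ times that for $[0,N]$.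
  · obtain ⟨N₀, hN₀⟩ := exists_nat_ge
      ((1 + ε) * Module.finrank K (F.pathSpan K S y p 0 k) / (ε / 2))
    obtain ⟨N, hNN₀, hN⟩ := exists_le_mul_of_polynomial_growth hpos (finrank_pathSpan_le hy) k N₀
      (half_pos hε)
    have hlow : (N₀ : ℝ) < Module.finrank K (F.pathSpan K S y p 0 N) :=
      Nat.cast_lt.2 (hNN₀.trans_lt (h N))
    have hsplit : Module.finrank K (F.pathSpan K S y p 0 N) ≤
        Module.finrank K (F.pathSpan K S y p 0 k) + Module.finrank K (F.pathSpan K S y p k N) :=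
      (Submodule.finrank_mono (pathSpan_le_sup k N)).trans
        (Submodule.finrank_add_le_finrank_add_finrank _ _)
    have hsplit' : (Module.finrank K (F.pathSpan K S y p 0 N) : ℝ) ≤
        Module.finrank K (F.pathSpan K S y p 0 k) + Module.finrank K (F.pathSpan K S y p k N) := by
      exact_mod_cast hsplit
    have hsmall : (1 + ε) * Module.finrank K (F.pathSpan K S y p 0 k) <
        ε / 2 * Module.finrank K (F.pathSpan K S y p 0 N) := by
      rw [div_le_iff₀ (half_pos hε)] at hN₀
      nlinarith
    have hle : (Module.finrank K (F.pathSpan K S y p 0 (N + k)) : ℝ) ≤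
        (1 + ε) * Module.finrank K (F.pathSpan K S y p k N) := by nlinarith
    refine ⟨k, N, Or.inr le_rfl, ?_, hle⟩
    have : (0 : ℝ) < Module.finrank K (F.pathSpan K S y p 0 (N + k)) :=
      Nat.cast_pos.2 (hpos _)
    exact_mod_cast pos_of_mul_pos_right (this.trans_le hle) (by linarith)

variable [IsScalarTower K A A]

/-- The generators of a Leavitt family. -/
def generators (F : LeavittFamily G A) : Set A :=
  Set.range F.vert ∪ Set.range F.edge ∪ Set.range F.ghost

/-- An element involves only finitely many edges, collected in `S₀`. The bound is uniform in `S`,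
`y` and `p` because these are chosen only once `S₀` is known. -/
theorem exists_shiftsBy {a : A} (ha : a ∈ NonUnitalAlgebra.adjoin K F.generators) :
    ∃ (S₀ : Finset E) (k : ℕ), ∀ S, S₀ ⊆ S → ∀ y p, F.vert y * p = p → F.ShiftsBy K S y p a k := by
  classical
  induction ha using NonUnitalAlgebra.adjoin_induction with
  | mem a ha =>
    obtain (⟨x, rfl⟩ | ⟨e, rfl⟩) | ⟨e, rfl⟩ := ha
    · exact ⟨∅, 0, fun S _ y p hp => shiftsBy_vert hp x⟩
    · exact ⟨{e}, 1, fun S hS y p hp => shiftsBy_edge hp (hS (by simp))⟩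
    · exact ⟨{e}, 1, fun S hS y p hp => shiftsBy_ghost hp (hS (by simp))⟩
  | add a b _ _ ha hb =>
    obtain ⟨S₁, k₁, h₁⟩ := ha
    obtain ⟨S₂, k₂, h₂⟩ := hb
    exact ⟨S₁ ∪ S₂, k₁ + k₂, fun S hS y p hp => (h₁ S (Finset.union_subset_left hS) y p hp).add
      (h₂ S (Finset.union_subset_right hS) y p hp)⟩
  | mul a b _ _ ha hb =>
    obtain ⟨S₁, k₁, h₁⟩ := ha
    obtain ⟨S₂, k₂, h₂⟩ := hb
    exact ⟨S₁ ∪ S₂, k₁ + k₂, fun S hS y p hp => (h₁ S (Finset.union_subset_left hS) y p hp).mul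
      (h₂ S (Finset.union_subset_right hS) y p hp)⟩
  | zero => exact ⟨∅, 0, fun S _ y p _ M N _ z _ => by rw [zero_mul]; exact zero_mem _⟩
  | smul c a _ ha =>
    obtain ⟨S₁, k₁, h₁⟩ := ha
    refine ⟨S₁, k₁, fun S hS y p hp M N hM z hz => ?_⟩
    rw [smul_mul_assoc]
    exact Submodule.smul_mem _ _ (h₁ S hS y p hp M N hM z hz)

theorem exists_shiftsBy_finset (hgen : NonUnitalAlgebra.adjoin K F.generators = ⊤)
    (T : Finset A) :
    ∃ (S₀ : Finset E) (k : ℕ), ∀ S, S₀ ⊆ S → ∀ y p, F.vert y * p = p →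
      ∀ a ∈ T, F.ShiftsBy K S y p a k := by
  classical
  have h : ∀ a : A, _ := fun a => exists_shiftsBy (K := K) (F := F) (a := a) (by simp [hgen])
  choose S₀ k h using h
  exact ⟨T.biUnion S₀, T.sup k, fun S hS y p hp a ha =>
    (h a S ((Finset.subset_biUnion_of_mem S₀ ha).trans hS) y p hp).mono (Finset.le_sup ha)⟩

/-- An algebra generated by a nonzero Leavitt family of a graph with finitely many vertices, in
which paths of distinct lengths are independent, is algebraically amenable unless the branching
vertices generate it as an ideal. -/
theorem isAlgebraicallyAmenable_of_branchingHull_ne_univ [Fintype V]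
    (hgen : NonUnitalAlgebra.adjoin K F.generators = ⊤) (hne : ∀ x, F.vert x ≠ 0)
    (hind : ∀ y (x : ℕ → V) (l : ℕ → List E), (∀ n, G.IsPath (x n) (l n) y) →
      (∀ n, (l n).length = n) → LinearIndependent K fun n => F.path (l n) (F.vert y))
    (hH : ∃ x, x ∉ F.branchingHull) : IsAlgebraicallyAmenable K A := by
  classical
  intro ε hε T
  obtain ⟨S₀, k, hS₀⟩ := exists_shiftsBy_finset hgen T
  by_cases hreg : ∀ x, x ∉ F.branchingHull → G.IsRegular x
  -- Only finitely many edges start outside the hull, so `S` can contain them all. Paths to `y` of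
  -- lengths $0,\dots,N$ then force dimension greater than $N$.
  · obtain ⟨y, hy, hlong⟩ := exists_vertex_arbitrarily_long_paths hH hreg
    choose x l hl hlen using hlong
    have hfin : {e | G.source e ∉ F.branchingHull}.Finite :=
      (Set.Finite.biUnion (Set.toFinite {x | x ∉ F.branchingHull})
        fun x hx => (hreg x hx).finite).subset fun e he => by simpa using he
    refine exists_folner (S := S₀ ∪ hfin.toFinset) hy (hne y)
      (hS₀ _ Finset.subset_union_left y _ (F.vert_mul_self y)) (Or.inr fun N => ?_) hε
    have := finiteDimensional_pathSpan (K := K) (S := S₀ ∪ hfin.toFinset) (p := F.vert y) hy 0 N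
    have hmem : ∀ n : Fin (N + 1), F.path (l n) (F.vert y) ∈
        F.pathSpan K (S₀ ∪ hfin.toFinset) y (F.vert y) 0 N := fun n =>
      path_mem_pathSpan (hl n) (fun e he => Finset.mem_toList.2 (Finset.mem_union_right _
        (hfin.mem_toFinset.2 (((hl n).notMem_of_hereditary range_mem_branchingHull hy).2 e he).1)))
        (Nat.zero_le _) (by rw [hlen]; omega)
    have hli : LinearIndependent K fun n : Fin (N + 1) =>
        (⟨_, hmem n⟩ : F.pathSpan K (S₀ ∪ hfin.toFinset) y (F.vert y) 0 N) :=
      LinearIndependent.of_comp (Submodule.subtype _)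
        ((hind y x l hl hlen).comp _ Fin.val_injective)
    simpa using hli.fintype_card_le_finrank
  · push Not at hreg
    obtain ⟨y, hy, hsing⟩ := hreg
    obtain ⟨p, hp, hyp, hghost⟩ := exists_ne_zero_ghost_mul_eq_zero hne hsing S₀
    exact exists_folner hy hp (hS₀ S₀ subset_rfl y p hyp) (Or.inl hghost) hε

end LeavittFamily

/-! ### The Leavitt path algebra and the equivalence. -/

namespace LeavittPathAlgebra

variable {K : Type u} {V : Type v} {E : Type w} [Field K] (G : DirectedGraph V E)

/-- The Leavitt family of generators of the Leavitt path algebra. -/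
def leavittFamily : LeavittFamily G (LeavittPathAlgebra K G) where
  vert := vertex K G
  edge := edge K G
  ghost := ghost K G
  vert_mul_self x := Subtype.ext <| by
    simpa [vertex, LeavittPath.gen] using rel_eq (LeavittPath.Rel.vertex_idem (K := K) (G := G) x)
  vert_mul_of_ne x y h := Subtype.ext <| by
    simpa [vertex, LeavittPath.gen] using
      rel_eq (LeavittPath.Rel.vertex_orth (K := K) (G := G) x y h)
  source_mul_edge e := Subtype.ext <| by
    simpa [vertex, edge, LeavittPath.gen] using
      rel_eq (LeavittPath.Rel.source_edge (K := K) (G := G) e)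
  edge_mul_range e := Subtype.ext <| by
    simpa [vertex, edge, LeavittPath.gen] using
      rel_eq (LeavittPath.Rel.edge_range (K := K) (G := G) e)
  range_mul_ghost e := Subtype.ext <| by
    simpa [vertex, ghost, LeavittPath.gen] using
      rel_eq (LeavittPath.Rel.range_ghost (K := K) (G := G) e)
  ghost_mul_source e := Subtype.ext <| by
    simpa [vertex, ghost, LeavittPath.gen] using
      rel_eq (LeavittPath.Rel.ghost_source (K := K) (G := G) e)
  ghost_mul_edge_self e := Subtype.ext <| by
    simpa [vertex, edge, ghost, LeavittPath.gen] using
      rel_eq (LeavittPath.Rel.ck1_same (K := K) (G := G) e)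
  ghost_mul_edge_of_ne e f h := Subtype.ext <| by
    simpa [edge, ghost, LeavittPath.gen] using
      rel_eq (LeavittPath.Rel.ck1_ne (K := K) (G := G) e f h)
  vert_eq_sum x h := Subtype.ext <| by
    simpa [vertex, edge, ghost, LeavittPath.gen] using
      rel_eq (LeavittPath.Rel.ck2 (K := K) (G := G) x h)

theorem adjoin_generators_leavittFamily :
    NonUnitalAlgebra.adjoin K (leavittFamily (K := K) G).generators = ⊤ := by
  refine top_unique ?_
  rintro ⟨a, ha⟩ -
  induction ha using NonUnitalAlgebra.adjoin_induction with
  | mem a ha =>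
    obtain ⟨x | e | e, rfl⟩ := ha
    · exact NonUnitalAlgebra.subset_adjoin K (Or.inl (Or.inl ⟨x, rfl⟩))
    · exact NonUnitalAlgebra.subset_adjoin K (Or.inl (Or.inr ⟨e, rfl⟩))
    · exact NonUnitalAlgebra.subset_adjoin K (Or.inr ⟨e, rfl⟩)
  | add x y hx hy ihx ihy => exact add_mem ihx ihy
  | zero => exact zero_mem _
  | mul x y hx hy ihx ihy => exact mul_mem ihx ihy
  | smul r x hx ih => exact SMulMemClass.smul_mem r ih

/-- The action of the Leavitt path algebra on a basis vector sends paths to basis vectors of degree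
the length of the path. -/
theorem exists_linearMap_path (y : V) : ∃ (κ : Type w)
    (φ : LeavittPathAlgebra K G →ₗ[K] (V × κ × ℤ →₀ K)), ∀ x l, G.IsPath x l y →
      ∃ k, φ ((leavittFamily G).path l ((leavittFamily G).vert y)) =
        Finsupp.single (x, k, (l.length : ℤ)) 1 := by
  obtain ⟨κ, ⟨k₀⟩, f, ρ, hv, he⟩ := LeavittPath.exists_graded_representation (K := K) G
  -- The map evaluates the action at the basis vector $(y,k_0,0)$.
  refine ⟨κ, ((LinearMap.applyₗ (Finsupp.single (y, k₀, (0 : ℤ)) (1 : K))).comp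
    ρ.toLinearMap).comp (NonUnitalSubalgebra.toSubmodule
      (NonUnitalAlgebra.adjoin K (Set.range (LeavittPath.gen K G)))).subtype, fun x l hl => ?_⟩
  change ∃ k, ρ ((leavittFamily G).path l ((leavittFamily G).vert y) : LeavittPathAlgebra K G)
    (Finsupp.single (y, k₀, (0 : ℤ)) (1 : K)) = _
  induction l generalizing x with
  | nil =>
    obtain rfl : x = y := hl
    exact ⟨k₀, hv x k₀ 0⟩
  | cons e l ih =>
    obtain ⟨k, hk⟩ := ih _ hl.2
    refine ⟨f e k, ?_⟩
    rw [LeavittFamily.path_cons, NonUnitalSubalgebra.coe_mul, map_mul, Module.End.mul_apply, hk]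
    refine (he e k l.length).trans ?_
    rw [hl.1, List.length_cons]
    push_cast
    rfl

theorem vert_leavittFamily_ne_zero (x : V) : (leavittFamily (K := K) G).vert x ≠ 0 := by
  obtain ⟨κ, φ, hφ⟩ := exists_linearMap_path (K := K) G x
  obtain ⟨k, hk⟩ := hφ x [] rfl
  intro h
  rw [LeavittFamily.path_nil, h, map_zero] at hk
  exact one_ne_zero (Finsupp.single_eq_zero.1 hk.symm)

/-- The images under `φ` are basis vectors of pairwise distinct degrees. -/
theorem linearIndependent_path (y : V) (x : ℕ → V) (l : ℕ → List E)
    (hl : ∀ n, G.IsPath (x n) (l n) y) (hlen : ∀ n, (l n).length = n) :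
    LinearIndependent K fun n =>
      (leavittFamily (K := K) G).path (l n) ((leavittFamily G).vert y) := by
  obtain ⟨κ, φ, hφ⟩ := exists_linearMap_path (K := K) G y
  choose k hk using fun n => hφ (x n) (l n) (hl n)
  refine LinearIndependent.of_comp φ ?_
  have : (φ ∘ fun n => (leavittFamily (K := K) G).path (l n) ((leavittFamily G).vert y)) =
      (fun q => Finsupp.single q (1 : K)) ∘ fun n => (x n, k n, ((l n).length : ℤ)) :=
    funext hk
  rw [this]
  refine (Finsupp.linearIndependent_single_one K _).comp _ fun m n hmn => ?_
  simpa [hlen] using (Prod.ext_iff.1 (Prod.ext_iff.1 hmn).2).2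

end LeavittPathAlgebra

theorem corollary5p12 {K : Type u} {V : Type v} {E : Type w} [Field K] [Fintype V] [Nonempty V]
    (G : DirectedGraph V E) :
    ¬ IsAlgebraicallyAmenable K (LeavittPathAlgebra K G) ↔
      IsProperlyInfinite (LeavittPathAlgebra K G) := by
  constructor
  · intro h
    refine ⟨⟨_, _, LeavittPathAlgebra.vert_leavittFamily_ne_zero G (Classical.arbitrary V)⟩, ?_⟩
    refine LeavittFamily.isProperlyInfiniteIdempotent_of_branchingHull_eq_univ
      (F := LeavittPathAlgebra.leavittFamily G) LeavittPathAlgebra.sum_vertex_mul ?_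
    by_contra! hH
    exact h (LeavittFamily.isAlgebraicallyAmenable_of_branchingHull_ne_univ
      (LeavittPathAlgebra.adjoin_generators_leavittFamily G)
      (LeavittPathAlgebra.vert_leavittFamily_ne_zero G)
      (LeavittPathAlgebra.linearIndependent_path G) hH)
  · rintro ⟨-, h⟩
    obtain ⟨s₁, s₂, t₁, t₂, h₁₁, h₂₂, h₁₂, -⟩ := h.exists_isometries one_mul mul_one
    exact not_isAlgebraicallyAmenable_of_isometries (u := (1 : LeavittPathAlgebra K G)) one_mul
      h₁₁ h₂₂ h₁₂
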